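/- Let $\mathfrak A$ be a $C^*$-algebra, $H$ a Hilbert $\mathfrak A$-module, and $\mathcal L(H)$ the $C^*$-algebra of adjointable operators on $H$, with unit $I$. Write $\mathcal R(T)$ for the range of an operator $T$ and $|T|=(T^*T)^{1/2}$. For an idempotent $Q\in\mathcal L(H)$ let $$m(Q)=\tfrac12\big(|Q^*|+Q^*\big)\,|Q^*|^\dagger\,\big(|Q^*|+I\big)^{-1}\big(|Q^*|+Q\big)$$ be its matched projection, where $\dagger$ denotes the Moore–Penrose inverse; $m(Q)$ is a projection (a self-adjoint idempotent). A closed submodule $M\subseteq H$ is orthogonally complemented if $H=M+M^\perp$. A pair $(P,Q)$ of a projection $P$ and an idempotent $Q$ with $Q^*=(2P-I)Q(2P-I)$ is called harmonious if $\overline{\mathcal R(PQ(I-P))}$ and $\overline{\mathcal R((I-P)QP)}$ are both orthogonally complemented in $H$. The pair $(m(Q),Q)$ always satisfies $Q^*=(2m(Q)-I)Q(2m(Q)-I)$. **Theorem.** Let $Q\in\mathcal L(H)$ be an idempotent that is not a projection and such that the matched pair $(m(Q),Q)$ is harmonious. Put $H_1=\mathcal R(m(Q))$, and let $U_{m(Q)}:H\to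 H_1\oplus H_1^\perp$ be the unitary $U_{m(Q)}h=\big(m(Q)h,(I-m(Q))h\big)^T$. Then there exist a positive operator $A\in\mathcal L(H_1)$ and a partial isometry $U\in\mathcal L(H_1,H_1^\perp)$ such that $$A\ge I_{H_1},\qquad \mathcal R(U^*)=\overline{\mathcal R(A-I_{H_1})},$$ and $$U_{m(Q)}\,Q\,U_{m(Q)}^*=\begin{pmatrix} A & -A^{1/2}(A-I_{H_1})^{1/2}U^*\\ UA^{1/2}(A-I_{H_1})^{1/2} & U(I_{H_1}-A)U^*\end{pmatrix}.$$ -/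

import Mathlib

set_option linter.unusedSectionVars false
namespace HilbertCStar

section MatchedProjection

variable {B : Type*} [CStarAlgebra B] [PartialOrder B] [StarOrderedRing B]

/-- `x` satisfies the four Moore-Penrose equations for `t`. -/
structure IsMoorePenrose {R : Type*} [Mul R] [Star R] (t x : R) : Prop where
  mul_mul_left : t * x * t = t
  mul_mul_right : x * t * x = x
  star_left : star (t * x) = t * x
  star_right : star (x * t) = x * t

theorem IsMoorePenrose.unique {R : Type*} [Semigroup R] [StarMul R] {t x y : R}
    (hx : IsMoorePenrose t x) (hy : IsMoorePenrose t y) : x = y := by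
  have h1 : t * x = t * y := by
    have h : t * y * (t * x) = t * x := by rw [← mul_assoc, hy.mul_mul_left]
    have h' := congrArg star h
    rw [star_mul, hx.star_left, hy.star_left, ← mul_assoc, hx.mul_mul_left] at h'
    exact h'.symm
  have h2 : x * t = y * t := by
    have h : x * t * (y * t) = x * t := by rw [mul_assoc, ← mul_assoc t, hy.mul_mul_left]
    have h' := congrArg star h
    rw [star_mul, hx.star_right, hy.star_right, mul_assoc, ← mul_assoc t,
      hx.mul_mul_left] at h'
    exact h'.symm
  rw [← hx.mul_mul_right, h2, mul_assoc, h1, ← mul_assoc, hy.mul_mul_right]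

open Classical in
/-- The Moore-Penrose inverse of `t`; it is `0` if `t` is not Moore-Penrose invertible. -/
noncomputable def moorePenrose {R : Type*} [Mul R] [Star R] [Zero R] (t : R) : R :=
  if h : ∃ x, IsMoorePenrose t x then h.choose else 0

/-- The matched projection
`m(q) = (1/2) (|q*| + q*) |q*|† (|q*| + 1)⁻¹ (|q*| + q)` of an idempotent `q`,
where `|t| = (t* t)^(1/2)`. -/
noncomputable def matchedProj (q : B) : B :=
  (1 / 2 : ℂ) • ((CFC.abs (star q) + star q) * moorePenrose (CFC.abs (star q)) *
    Ring.inverse (CFC.abs (star q) + 1) * (CFC.abs (star q) + q))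

theorem abs_mul_abs_star (q : B) : CFC.abs (star q) * CFC.abs (star q) = q * star q := by
  rw [CFC.abs_mul_abs, star_star]

theorem star_abs (q : B) : star (CFC.abs q) = CFC.abs q :=
  (CFC.abs_nonneg q).isSelfAdjoint

theorem mul_abs_star {q : B} (hq : IsIdempotentElem q) :
    q * CFC.abs (star q) = CFC.abs (star q) := by
  have h : (q * CFC.abs (star q) - CFC.abs (star q)) *
      star (q * CFC.abs (star q) - CFC.abs (star q)) = 0 := by
    have e : q * CFC.abs (star q) - CFC.abs (star q) = (q - 1) * CFC.abs (star q) := by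
      noncomm_ring
    rw [e, star_mul, star_abs, mul_assoc, ← mul_assoc (CFC.abs (star q)), abs_mul_abs_star,
      ← mul_assoc, ← mul_assoc, sub_mul, hq.eq, one_mul, sub_self, zero_mul, zero_mul]
  exact sub_eq_zero.mp (CStarRing.mul_star_self_eq_zero_iff _ |>.mp h)

theorem abs_star_mul_star {q : B} (hq : IsIdempotentElem q) :
    CFC.abs (star q) * star q = CFC.abs (star q) := by
  have := congrArg star (mul_abs_star hq)
  rwa [star_mul, star_abs] at this

theorem isUnit_abs_add_one (q : B) : IsUnit (CFC.abs q + 1) := by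
  have h : (1 : B) ≤ CFC.abs q + 1 := le_add_of_nonneg_left (CFC.abs_nonneg q)
  exact CStarAlgebra.isUnit_of_le 1 h

/-- `|q*|` has a self-adjoint Moore-Penrose inverse that commutes with it. -/
theorem moorePenrose_abs_star {q : B} (hq : IsIdempotentElem q) :
    IsMoorePenrose (CFC.abs (star q)) (moorePenrose (CFC.abs (star q))) ∧
    IsSelfAdjoint (moorePenrose (CFC.abs (star q))) ∧
    Commute (CFC.abs (star q)) (moorePenrose (CFC.abs (star q))) ∧
    CFC.abs (star q) * moorePenrose (CFC.abs (star q)) * q = q := by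
  set b := CFC.abs (star q) with hb
  have hq1 : q * q = q := hq.eq
  have hq2 : star q * star q = star q := by rw [← star_mul, hq1]
  have hbs : star b = b := star_abs _
  set v : B := 1 + star (q - star q) * (q - star q) with hv
  have hve : v = q * star q + star q * q - q - star q + 1 := by
    simp only [hv, star_sub, star_star, sub_mul, mul_sub, hq1, hq2]
    abel
  have hvs : star v = v := by
    rw [hve]; simp only [star_add, star_sub, star_mul, star_star, star_one]; abel
  have hvu : IsUnit v :=
    CStarAlgebra.isUnit_of_le 1 (le_add_of_nonneg_right (star_mul_self_nonneg _))
  obtain ⟨u, hu⟩ := hvu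
  have hqv : q * v = q * star q * q := by
    rw [hve]; simp only [mul_add, mul_sub, ← mul_assoc, hq1, mul_one]; abel
  have hvq : v * q = q * star q * q := by
    rw [hve]; simp only [add_mul, sub_mul, mul_assoc, hq1, one_mul]; abel
  have hcq : Commute v q := hvq.trans hqv.symm
  have hcq' : Commute v (star q) := by
    have := congrArg star hcq.eq
    rw [star_mul, star_mul, hvs] at this
    exact this.symm
  have hcb : Commute v b := by
    have : Commute (star (star q) * star q) v := by
      rw [star_star]; exact (hcq.mul_right hcq').symm
    exact (this.cfcₙ_nnreal NNReal.sqrt).symm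
  set w : B := ↑u⁻¹ with hw
  have hvw : v * w = 1 := by rw [← hu, hw, Units.mul_inv]
  have hcwq : Commute w q := by rw [hw]; rw [← hu] at hcq; exact hcq.units_inv_left
  have hcwq' : Commute w (star q) := by rw [hw]; rw [← hu] at hcq'; exact hcq'.units_inv_left
  have hcwb : Commute w b := by rw [hw]; rw [← hu] at hcb; exact hcb.units_inv_left
  have hws : star w = w := by
    have h1 : star w * v = 1 := by
      have := congrArg star hvw
      rwa [star_mul, star_one, hvs] at this
    calc star w = star w * (v * w) := by rw [hvw, mul_one]
      _ = w := by rw [← mul_assoc, h1, one_mul]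
  have hbb : b * b = q * star q := abs_mul_abs_star q
  have hqb : q * b = b := mul_abs_star hq
  have hpq : b * (b * w) * q = q := by
    rw [← mul_assoc, hbb, mul_assoc, hcwq.eq, ← mul_assoc, ← hqv, mul_assoc, hvw, mul_one]
  have hpb : b * (b * w) * b = b := by
    calc b * (b * w) * b = b * (b * w) * q * b := by rw [mul_assoc _ q b, hqb]
      _ = b := by rw [hpq, hqb]
  have hX : IsMoorePenrose b (b * w) := by
    have hbwb : b * w * b = b * (b * w) := by rw [mul_assoc, hcwb.eq]
    have hsa : star (b * (b * w)) = b * (b * w) := by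
      rw [star_mul, star_mul, hbs, hws, hcwb.eq, hbwb]
    refine ⟨hpb, ?_, hsa, ?_⟩
    · rw [hbwb]
      have : b * (b * w) * (b * w) = b * (b * w) * b * w := by simp only [mul_assoc]
      rw [this, hpb]
    · rw [hbwb, hsa]
  have hex : ∃ x, IsMoorePenrose b x := ⟨_, hX⟩
  have hmp : moorePenrose b = b * w := by
    have : moorePenrose b = hex.choose := by rw [moorePenrose, dif_pos hex]
    rw [this]
    exact hex.choose_spec.unique hX
  rw [hmp]
  refine ⟨hX, ?_, ?_, hpq⟩
  · rw [isSelfAdjoint_iff, star_mul, hws, hbs, hcwb.eq]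
  · exact (Commute.refl b).mul_right hcwb.symm

theorem matchedProj_isStarProjection {q : B} (hq : IsIdempotentElem q) :
    IsStarProjection (matchedProj q) := by
  obtain ⟨hmp, hsa, hcx, -⟩ := moorePenrose_abs_star hq
  have hqb := mul_abs_star hq
  have hbq := abs_star_mul_star hq
  have hbb := abs_mul_abs_star q
  have hbs := star_abs (star q)
  have hunit := isUnit_abs_add_one (star q)
  rw [matchedProj]
  set b := CFC.abs (star q)
  set x := moorePenrose b
  set c := Ring.inverse (b + 1) with hc
  have hbc : (b + 1) * c = 1 := Ring.mul_inverse_cancel _ hunit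
  have hcb : c * (b + 1) = 1 := Ring.inverse_mul_cancel _ hunit
  have hcs : star c = c := by
    have h1 : star c * (b + 1) = 1 := by
      have := congrArg star hbc
      rwa [star_mul, star_one, star_add, star_one, hbs] at this
    calc star c = star c * ((b + 1) * c) := by rw [hbc, mul_one]
      _ = c := by rw [← mul_assoc, h1, one_mul]
  have hcx' : Commute x c := by
    have h : Commute x (b + 1) := (hcx.symm).add_right (Commute.one_right x)
    calc x * c = (c * (b + 1)) * x * c := by rw [hcb, one_mul]
      _ = c * (x * (b + 1)) * c := by rw [h.eq]; simp only [mul_assoc]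
      _ = c * x * ((b + 1) * c) := by simp only [mul_assoc]
      _ = c * x := by rw [hbc, mul_one]
  have hmid : (b + q) * (b + star q) = (2 : ℂ) • ((b + 1) * b) := by
    rw [add_mul, mul_add, mul_add, hqb, hbq, ← hbb, two_smul, add_mul, one_mul]
    abel
  constructor
  · rw [IsIdempotentElem, smul_mul_smul_comm]
    have : (b + star q) * x * c * (b + q) * ((b + star q) * x * c * (b + q)) =
        (b + star q) * x * c * ((b + q) * (b + star q)) * x * c * (b + q) := by
      simp only [mul_assoc]
    rw [this, hmid]
    have h2 : (b + star q) * x * c * ((2 : ℂ) • ((b + 1) * b)) * x * c * (b + q) =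
        (2 : ℂ) • ((b + star q) * (x * (c * (b + 1)) * b * x) * c * (b + q)) := by
      simp only [mul_smul_comm, smul_mul_assoc, mul_assoc]
    rw [h2, hcb, mul_one, hmp.mul_mul_right, smul_smul]
    norm_num
  · rw [isSelfAdjoint_iff, star_smul]
    simp only [star_mul, star_add, hbs, star_star, hcs, hsa.star_eq]
    have : star (1 / 2 : ℂ) = 1 / 2 := by simp
    rw [this]
    congr 1
    have : (b + star q) * (c * (x * (b + q))) = (b + star q) * (c * x) * (b + q) := by
      simp only [mul_assoc]
    rw [this, ← hcx'.eq]
    simp only [mul_assoc]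

/-- `q* = (2 m(q) - 1) q (2 m(q) - 1)`. -/
theorem star_eq_matchedProj {q : B} (hq : IsIdempotentElem q) :
    star q = (2 * matchedProj q - 1) * q * (2 * matchedProj q - 1) := by
  have hm := matchedProj_isStarProjection hq
  obtain ⟨hmp, hsa, hcx, hbxq⟩ := moorePenrose_abs_star hq
  have hunit := isUnit_abs_add_one (star q)
  have key : (2 * matchedProj q - 1) * q = star q * moorePenrose (CFC.abs (star q)) * q := by
    rw [matchedProj]
    set b := CFC.abs (star q)
    set x := moorePenrose b
    set c := Ring.inverse (b + 1) with hc
    have hcb : c * (b + 1) = 1 := Ring.inverse_mul_cancel _ hunit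
    have h2 : (2 : B) * ((1 / 2 : ℂ) • ((b + star q) * x * c * (b + q))) =
        (b + star q) * x * c * (b + q) := by
      rw [two_mul, ← add_smul]; norm_num
    rw [h2, sub_mul, one_mul]
    have : (b + star q) * x * c * (b + q) * q = (b + star q) * x * (c * (b + 1)) * q := by
      have : (b + q) * q = (b + 1) * q := by rw [add_mul, add_mul, hq.eq, one_mul]
      rw [mul_assoc _ (b + q), this]
      simp only [mul_assoc]
    rw [this, hcb, mul_one, add_mul, add_mul, hbxq]
    abel
  have hs : star (2 * matchedProj q - 1) = 2 * matchedProj q - 1 := by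
    rw [star_sub, star_one, two_mul, star_add, hm.isSelfAdjoint.star_eq]
  have hsq : (2 * matchedProj q - 1) * (2 * matchedProj q - 1) = 1 := by
    have e : (2 * matchedProj q - 1) * (2 * matchedProj q - 1) =
        4 * (matchedProj q * matchedProj q) - 4 * matchedProj q + 1 := by noncomm_ring
    rw [e, hm.isIdempotentElem.eq, sub_self, zero_add]
  have key' : star q * (2 * matchedProj q - 1) = (2 * matchedProj q - 1) * q := by
    have := congrArg star key
    rw [star_mul, hs, star_mul, star_mul, star_star, hsa.star_eq, ← mul_assoc] at this
    rw [this, key]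
  rw [← key', mul_assoc, hsq, mul_one]

end MatchedProjection
section Adjointable

/-- The adjointable operators between two Hilbert C*-modules, as a subspace of the bounded linear
operators. (An adjointable map is automatically bounded and linear, see `Adj.ofPair`.) -/
def adjointableSubmodule (A E F : Type*) [NonUnitalCStarAlgebra A] [PartialOrder A]
    [NormedAddCommGroup E] [NormedSpace ℂ E] [SMul A E] [CStarModule A E]
    [NormedAddCommGroup F] [NormedSpace ℂ F] [SMul A F] [CStarModule A F] :
    Submodule ℂ (E →L[ℂ] F) where
  carrier := {T | ∃ S : F →L[ℂ] E, ∀ x y, inner A (T x) y = inner A x (S y)}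
  add_mem' := by
    rintro T T' ⟨S, hS⟩ ⟨S', hS'⟩
    exact ⟨S + S', fun x y => by simp [hS, hS']⟩
  zero_mem' := ⟨0, fun x y => by simp⟩
  smul_mem' := by
    rintro c T ⟨S, hS⟩
    exact ⟨star c • S, fun x y => by simp [hS]⟩

/-- `Adj A E F` is the space `𝓛(E, F)` of adjointable operators from `E` to `F`. -/
def Adj (A E F : Type*) [NonUnitalCStarAlgebra A] [PartialOrder A]
    [NormedAddCommGroup E] [NormedSpace ℂ E] [SMul A E] [CStarModule A E]
    [NormedAddCommGroup F] [NormedSpace ℂ F] [SMul A F] [CStarModule A F] : Type _ :=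
  ↥(adjointableSubmodule A E F)

variable {A E F G : Type*} [NonUnitalCStarAlgebra A] [PartialOrder A]
  [NormedAddCommGroup E] [NormedSpace ℂ E] [SMul A E] [CStarModule A E]
  [NormedAddCommGroup F] [NormedSpace ℂ F] [SMul A F] [CStarModule A F]
  [NormedAddCommGroup G] [NormedSpace ℂ G] [SMul A G] [CStarModule A G]

theorem ext_inner_right {x y : E} (h : ∀ z : E, inner A z x = inner A z y) : x = y := by
  rw [← sub_eq_zero, ← CStarModule.inner_self (A := A), CStarModule.inner_sub_right, h, sub_self]

theorem ext_inner_left {x y : E} (h : ∀ z : E, inner A x z = inner A y z) : x = y := by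
  rw [← sub_eq_zero, ← CStarModule.inner_self (A := A), CStarModule.inner_sub_left, h, sub_self]

namespace Adj

noncomputable instance : NormedAddCommGroup (Adj A E F) :=
  inferInstanceAs (NormedAddCommGroup ↥(adjointableSubmodule A E F))

noncomputable instance : NormedSpace ℂ (Adj A E F) :=
  inferInstanceAs (NormedSpace ℂ ↥(adjointableSubmodule A E F))

/-- The underlying bounded linear operator. -/
def toCLM (T : Adj A E F) : E →L[ℂ] F := Subtype.val T

instance : FunLike (Adj A E F) E F where
  coe T := T.toCLM
  coe_injective := fun _ _ h => Subtype.ext (DFunLike.coe_injective h)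

@[ext] theorem ext {T T' : Adj A E F} (h : ∀ x, T x = T' x) : T = T' := DFunLike.ext _ _ h

@[simp] theorem toCLM_apply (T : Adj A E F) (x : E) : T.toCLM x = T x := rfl

theorem norm_toCLM (T : Adj A E F) : ‖T.toCLM‖ = ‖T‖ := rfl

@[simp] theorem add_apply (T T' : Adj A E F) (x : E) : (T + T') x = T x + T' x := rfl
@[simp] theorem sub_apply (T T' : Adj A E F) (x : E) : (T - T') x = T x - T' x := rfl
@[simp] theorem neg_apply (T : Adj A E F) (x : E) : (-T) x = -T x := rfl
@[simp] theorem zero_apply (x : E) : (0 : Adj A E F) x = 0 := rfl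
@[simp] theorem smul_apply (c : ℂ) (T : Adj A E F) (x : E) : (c • T) x = c • T x := rfl

theorem map_add' (T : Adj A E F) (x y : E) : T (x + y) = T x + T y := map_add T.toCLM x y
theorem map_smul' (T : Adj A E F) (c : ℂ) (x : E) : T (c • x) = c • T x := map_smul T.toCLM c x

instance : ContinuousLinearMapClass (Adj A E F) ℂ E F where
  map_add := map_add'
  map_smulₛₗ := map_smul'
  map_continuous T := T.toCLM.continuous

theorem le_norm (T : Adj A E F) (x : E) : ‖T x‖ ≤ ‖T‖ * ‖x‖ := T.toCLM.le_opNorm x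

/-- The adjoint of an adjointable operator. -/
noncomputable def adjoint (T : Adj A E F) : Adj A F E :=
  ⟨T.2.choose, T.toCLM, fun y x => by
    rw [← CStarModule.star_inner, ← T.2.choose_spec, CStarModule.star_inner]; rfl⟩

theorem inner_left (T : Adj A E F) (x : E) (y : F) :
    inner A (T x) y = inner A x (T.adjoint y) := T.2.choose_spec x y

theorem inner_right (T : Adj A E F) (x : F) (y : E) :
    inner A x (T y) = inner A (T.adjoint x) y := by
  rw [← CStarModule.star_inner, inner_left, CStarModule.star_inner]

theorem adjoint_eq (T : Adj A E F) (S : Adj A F E)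
    (h : ∀ x y, inner A (T x) y = inner A x (S y)) : T.adjoint = S :=
  ext fun y => ext_inner_right (A := A) fun x => by rw [← inner_left, h]

/-- An adjointable operator commutes with the action of the C*-algebra. -/
theorem map_op_smul (T : Adj A E F) (a : A) (x : E) : T (a • x) = a • T x :=
  ext_inner_right (A := A) fun y => by
    rw [inner_right, CStarModule.inner_op_smul_right, CStarModule.inner_op_smul_right, inner_right]

/-- Composition of adjointable operators. -/
noncomputable def comp (T : Adj A F G) (S : Adj A E F) : Adj A E G :=
  ⟨T.toCLM.comp S.toCLM, S.adjoint.toCLM.comp T.adjoint.toCLM, fun x y => by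
    simp [inner_left]⟩

@[simp] theorem comp_apply (T : Adj A F G) (S : Adj A E F) (x : E) : T.comp S x = T (S x) := rfl

@[simp] theorem adjoint_adjoint (T : Adj A E F) : T.adjoint.adjoint = T :=
  adjoint_eq _ _ fun x y => by rw [inner_right]

section Complete

variable [StarOrderedRing A]

theorem exists_clm {E F : Type*}
    [NormedAddCommGroup E] [NormedSpace ℂ E] [SMul A E] [CStarModule A E]
    [NormedAddCommGroup F] [NormedSpace ℂ F] [SMul A F] [CStarModule A F]
    [CompleteSpace E] [CompleteSpace F] (T : E → F) (S : F → E)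
    (h : ∀ x y, inner A (T x) y = inner A x (S y)) : ∃ T' : E →L[ℂ] F, ∀ x, T' x = T x := by
  let L : E →ₗ[ℂ] F :=
    { toFun := T
      map_add' := fun x y => ext_inner_left (A := A) fun z => by simp [h]
      map_smul' := fun c x => ext_inner_left (A := A) fun z => by simp [h] }
  refine ⟨⟨L, L.continuous_of_seq_closed_graph fun u x y hu hy => ?_⟩, fun _ => rfl⟩
  refine ext_inner_left (A := A) fun z => ?_
  have h1 : Filter.Tendsto (fun n => inner A (T (u n)) z) Filter.atTop (nhds (inner A y z)) :=
    ((CStarModule.continuous_inner (A := A) (E := F)).tendsto (y, z)).comp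
      (hy.prodMk_nhds tendsto_const_nhds)
  have h2 : Filter.Tendsto (fun n => inner A (T (u n)) z) Filter.atTop
      (nhds (inner A (T x) z)) := by
    simp only [h]
    exact ((CStarModule.continuous_inner (A := A) (E := E)).tendsto (x, S z)).comp
      (hu.prodMk_nhds tendsto_const_nhds)
  exact tendsto_nhds_unique h1 h2

/-- Two maps that are adjoint to each other are adjointable operators: linearity and boundedness
are automatic. -/
noncomputable def ofPair [CompleteSpace E] [CompleteSpace F] (T : E → F) (S : F → E)
    (h : ∀ x y, inner A (T x) y = inner A x (S y)) : Adj A E F :=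
  ⟨(exists_clm (A := A) T S h).choose, by
    have h' : ∀ y x, inner A (S y) x = inner A y (T x) := fun y x => by
      rw [← CStarModule.star_inner, ← h, CStarModule.star_inner]
    refine ⟨(exists_clm (A := A) S T h').choose, fun x y => ?_⟩
    rw [(exists_clm (A := A) T S h).choose_spec, (exists_clm (A := A) S T h').choose_spec, h]⟩

@[simp] theorem ofPair_apply [CompleteSpace E] [CompleteSpace F] (T : E → F) (S : F → E)
    (h : ∀ x y, inner A (T x) y = inner A x (S y)) (x : E) : ofPair T S h x = T x :=
  (exists_clm (A := A) T S h).choose_spec x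

@[simp] theorem adjoint_ofPair_apply [CompleteSpace E] [CompleteSpace F] (T : E → F) (S : F → E)
    (h : ∀ x y, inner A (T x) y = inner A x (S y)) (y : F) : (ofPair T S h).adjoint y = S y :=
  ext_inner_right (A := A) fun x => by rw [← inner_left, ofPair_apply, h]

end Complete

/-! The adjointable operators on a Hilbert C*-module form a C*-algebra. -/

noncomputable instance : Mul (Adj A E E) := ⟨comp⟩
noncomputable instance : One (Adj A E E) :=
  ⟨⟨ContinuousLinearMap.id ℂ E, ContinuousLinearMap.id ℂ E, fun _ _ => rfl⟩⟩
noncomputable instance : Star (Adj A E E) := ⟨adjoint⟩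

@[simp] theorem mul_apply (S T : Adj A E E) (x : E) : (S * T) x = S (T x) := rfl
@[simp] theorem one_apply (x : E) : (1 : Adj A E E) x = x := rfl
theorem star_eq_adjoint (T : Adj A E E) : star T = T.adjoint := rfl

noncomputable instance : NormedRing (Adj A E E) :=
  { (inferInstance : NormedAddCommGroup (Adj A E E)) with
    mul := (· * ·)
    one := 1
    left_distrib := fun R S T => ext fun x => by simp
    right_distrib := fun R S T => ext fun x => by simp
    zero_mul := fun T => ext fun x => by simp
    mul_zero := fun T => ext fun x => by simp
    mul_assoc := fun R S T => ext fun x => by simp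
    one_mul := fun T => ext fun x => by simp
    mul_one := fun T => ext fun x => by simp
    norm_mul_le := fun S T => S.toCLM.opNorm_comp_le T.toCLM }

noncomputable instance : NormedAlgebra ℂ (Adj A E E) :=
  { Algebra.ofModule (R := ℂ) (A := Adj A E E) (fun c S T => ext fun x => by simp)
      (fun c S T => ext fun x => by simp) with
    norm_smul_le := fun c T => norm_smul_le c T }

variable [StarOrderedRing A]

noncomputable instance : StarRing (Adj A E E) where
  star_involutive := adjoint_adjoint
  star_mul S T := adjoint_eq _ _ fun x y => by simp [star_eq_adjoint, inner_left]
  star_add S T := adjoint_eq _ _ fun x y => by simp [star_eq_adjoint, inner_left]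

instance : StarModule ℂ (Adj A E E) where
  star_smul c T := adjoint_eq _ _ fun x y => by simp [star_eq_adjoint, inner_left]

theorem norm_mul_self_le (T : Adj A E E) : ‖T‖ * ‖T‖ ≤ ‖star T * T‖ := by
  have h : ‖T‖ ≤ √‖star T * T‖ := by
    rw [← norm_toCLM]
    refine ContinuousLinearMap.opNorm_le_bound _ (Real.sqrt_nonneg _) fun x => ?_
    refine abs_le_of_sq_le_sq' ?_ (by positivity) |>.2
    rw [mul_pow, Real.sq_sqrt (norm_nonneg _), toCLM_apply, CStarModule.norm_sq_eq A, inner_left]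
    calc _ ≤ ‖x‖ * ‖(star T * T) x‖ := CStarModule.norm_inner_le E
      _ ≤ ‖x‖ * (‖star T * T‖ * ‖x‖) := by gcongr; exact le_norm _ _
      _ = _ := by ring
  calc ‖T‖ * ‖T‖ ≤ √‖star T * T‖ * √‖star T * T‖ := by gcongr
    _ = _ := Real.mul_self_sqrt (norm_nonneg _)

instance : CStarRing (Adj A E E) := CStarRing.of_le_norm_mul_star_self fun T => by
  have hle : ∀ S : Adj A E E, ‖S‖ ≤ ‖star S‖ := fun S => by
    rcases eq_or_ne S 0 with rfl | hS
    · simp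
    · have := (norm_mul_self_le S).trans (norm_mul_le _ _)
      exact le_of_mul_le_mul_right this (norm_pos_iff.mpr hS)
  calc ‖T‖ * ‖T‖ ≤ ‖star T‖ * ‖star T‖ := by gcongr <;> exact hle T
    _ ≤ ‖star (star T) * star T‖ := norm_mul_self_le _
    _ = _ := by rw [star_star]

instance [CompleteSpace E] : CompleteSpace (Adj A E E) := by
  refine Metric.complete_of_cauchySeq_tendsto fun u hu => ?_
  have h1 : CauchySeq fun n => (u n).toCLM := hu.map (uniformContinuous_subtype_val)
  have hs : CauchySeq fun n => star (u n) := by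
    rw [Metric.cauchySeq_iff'] at hu ⊢
    simpa only [dist_eq_norm, ← star_sub, norm_star] using hu
  have h2 : CauchySeq fun n => (star (u n)).toCLM := hs.map (uniformContinuous_subtype_val)
  obtain ⟨T, hT⟩ := cauchySeq_tendsto_of_complete h1
  obtain ⟨S, hS⟩ := cauchySeq_tendsto_of_complete h2
  refine ⟨⟨T, S, fun x y => ?_⟩, tendsto_subtype_rng.mpr hT⟩
  have hTx : Filter.Tendsto (fun n => u n x) Filter.atTop (nhds (T x)) :=
    ((ContinuousLinearMap.apply ℂ E x).continuous.tendsto T).comp hT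
  have hSy : Filter.Tendsto (fun n => (star (u n)) y) Filter.atTop (nhds (S y)) :=
    ((ContinuousLinearMap.apply ℂ E y).continuous.tendsto S).comp hS
  have e1 := ((CStarModule.continuous_inner (A := A) (E := E)).tendsto (T x, y)).comp
    (hTx.prodMk_nhds tendsto_const_nhds)
  have e2 := ((CStarModule.continuous_inner (A := A) (E := E)).tendsto (x, S y)).comp
    (Filter.Tendsto.prodMk_nhds (tendsto_const_nhds (x := x)) hSy)
  refine tendsto_nhds_unique e1 (e2.congr fun n => ?_)
  exact (inner_left (u n) x y).symm

noncomputable instance [CompleteSpace E] : CStarAlgebra (Adj A E E) where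

/-- `S ≤ T` means that `T - S` is a positive element of the C*-algebra `𝓛(E)`. -/
noncomputable instance [CompleteSpace E] : PartialOrder (Adj A E E) :=
  CStarAlgebra.spectralOrder _

instance [CompleteSpace E] : StarOrderedRing (Adj A E E) :=
  CStarAlgebra.spectralOrderedRing _

end Adj
end Adjointable

section Submodules

/-- A closed submodule of a Hilbert C*-module. -/
structure ClosedSub (A E : Type*) [NonUnitalCStarAlgebra A] [PartialOrder A]
    [NormedAddCommGroup E] [NormedSpace ℂ E] [SMul A E] [CStarModule A E]
    extends Submodule ℂ E where
  op_smul_mem' : ∀ (a : A) {x : E}, x ∈ carrier → a • x ∈ carrier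
  isClosed' : IsClosed carrier

variable {A E F : Type*} [NonUnitalCStarAlgebra A] [PartialOrder A]
  [NormedAddCommGroup E] [NormedSpace ℂ E] [SMul A E] [CStarModule A E]
  [NormedAddCommGroup F] [NormedSpace ℂ F] [SMul A F] [CStarModule A F]

namespace ClosedSub

instance : SetLike (ClosedSub A E) E where
  coe M := M.carrier
  coe_injective M N h := by
    obtain ⟨M, _, _⟩ := M
    obtain ⟨N, _, _⟩ := N
    congr
    exact SetLike.coe_injective h

variable (M : ClosedSub A E)

noncomputable instance : NormedAddCommGroup ↥M :=
  inferInstanceAs (NormedAddCommGroup ↥M.toSubmodule)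

noncomputable instance : NormedSpace ℂ ↥M :=
  inferInstanceAs (NormedSpace ℂ ↥M.toSubmodule)

instance : SMul A ↥M := ⟨fun a x => ⟨a • x.1, M.op_smul_mem' a x.2⟩⟩

noncomputable instance : CStarModule A ↥M where
  inner x y := inner A x.1 y.1
  inner_add_right := CStarModule.inner_add_right
  inner_self_nonneg := CStarModule.inner_self_nonneg
  inner_self {x} := CStarModule.inner_self.trans (Subtype.ext_iff (a1 := x) (a2 := 0)).symm
  inner_op_smul_right := CStarModule.inner_op_smul_right
  inner_smul_right_complex := CStarModule.inner_smul_right_complex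
  star_inner _ _ := CStarModule.star_inner _ _
  norm_eq_sqrt_norm_inner_self x := CStarModule.norm_eq_sqrt_norm_inner_self x.1

instance [CompleteSpace E] : CompleteSpace ↥M :=
  M.isClosed'.completeSpace_coe

variable {M} in
theorem inner_coe (x y : M) : inner A x y = inner A (x : E) (y : E) := rfl

@[simp] theorem coe_add (x y : M) : ((x + y : M) : E) = x + y := rfl
@[simp] theorem coe_sub (x y : M) : ((x - y : M) : E) = x - y := rfl

theorem continuous_op_smul (a : A) : Continuous fun x : E => a • x := by
  refine (LipschitzWith.of_dist_le_mul (K := ‖a‖₊) fun x y => ?_).continuous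
  have e : a • x - a • y = a • (x - y) :=
    ext_inner_right (A := A) fun z => by simp [mul_sub]
  rw [dist_eq_norm, dist_eq_norm, e]
  have h : ‖a • (x - y)‖ ^ 2 ≤ (‖a‖ * ‖x - y‖) ^ 2 := by
    rw [CStarModule.norm_sq_eq A, CStarModule.inner_op_smul_right, CStarModule.inner_op_smul_left]
    calc _ ≤ ‖a‖ * (‖inner A (x - y) (x - y)‖ * ‖star a‖) :=
          (norm_mul_le _ _).trans (by gcongr; exact norm_mul_le _ _)
      _ = _ := by rw [norm_star, ← CStarModule.norm_sq_eq A]; ring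
  exact abs_le_of_sq_le_sq' h (by positivity) |>.2

variable [StarOrderedRing A]

/-- The orthogonal complement `M^⊥ = {x | ⟨x, y⟩ = 0 for every y ∈ M}`. -/
def orthogonal : ClosedSub A E where
  carrier := {x | ∀ y ∈ M, inner A x y = 0}
  add_mem' := fun hx hy z hz => by simp [hx z hz, hy z hz]
  zero_mem' := fun z _ => by simp
  smul_mem' := fun c x hx z hz => by simp [hx z hz]
  op_smul_mem' := fun a x hx z hz => by simp [hx z hz]
  isClosed' := by
    have : {x : E | ∀ y ∈ M, inner A x y = 0} = ⋂ y ∈ M, {x | inner A x y = 0} := by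
      ext; simp
    rw [this]
    refine isClosed_biInter fun y _ => isClosed_eq ?_ continuous_const
    exact (CStarModule.continuous_inner (A := A) (E := E)).comp
      (continuous_id.prodMk continuous_const)

theorem mem_orthogonal {x : E} : x ∈ M.orthogonal ↔ ∀ y ∈ M, inner A x y = 0 := Iff.rfl

/-- `M` is orthogonally complemented: `H = M + M^⊥`. -/
def IsOrthComplemented : Prop :=
  ∀ x : E, ∃ y ∈ M, ∃ z ∈ M.orthogonal, x = y + z

end ClosedSub

namespace Adj

variable [StarOrderedRing A]

/-- The closure of the range of an adjointable operator. -/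
def closedRange (T : Adj A E F) : ClosedSub A F where
  toSubmodule := (LinearMap.range T.toCLM.toLinearMap).topologicalClosure
  op_smul_mem' := fun a x hx => by
    refine map_mem_closure (ClosedSub.continuous_op_smul a) hx ?_
    rintro _ ⟨y, rfl⟩
    exact ⟨a • y, map_op_smul T a y⟩
  isClosed' := Submodule.isClosed_topologicalClosure _

/-- The range of a projection. -/
def projRange (P : Adj A E E) (hP : IsStarProjection P) : ClosedSub A E where
  toSubmodule := LinearMap.range P.toCLM.toLinearMap
  op_smul_mem' := by
    rintro a _ ⟨y, rfl⟩
    exact ⟨a • y, map_op_smul P a y⟩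
  isClosed' := by
    have : (LinearMap.range P.toCLM.toLinearMap : Set E) = {x | P x = x} := by
      ext x
      constructor
      · rintro ⟨y, rfl⟩
        exact DFunLike.congr_fun hP.isIdempotentElem.eq y
      · exact fun h => ⟨x, h⟩
    change IsClosed (LinearMap.range P.toCLM.toLinearMap : Set E)
    rw [this]
    exact isClosed_eq P.toCLM.continuous continuous_id

theorem coe_closedRange (T : Adj A E F) : (T.closedRange : Set F) = closure (Set.range T) := rfl

theorem coe_projRange (P : Adj A E E) (hP : IsStarProjection P) :
    (P.projRange hP : Set E) = Set.range P := rfl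

theorem apply_mem_projRange (P : Adj A E E) (hP : IsStarProjection P) (x : E) :
    P x ∈ P.projRange hP := ⟨x, rfl⟩

theorem sub_apply_mem_orthogonal (P : Adj A E E) (hP : IsStarProjection P) (x : E) :
    (1 - P) x ∈ (P.projRange hP).orthogonal := by
  rintro _ ⟨y, rfl⟩
  change inner A ((1 - P) x) (P y) = 0
  rw [inner_right, ← star_eq_adjoint, hP.isSelfAdjoint.star_eq, ← mul_apply, mul_sub, mul_one,
    hP.isIdempotentElem.eq, sub_self, zero_apply, CStarModule.inner_zero_left]

variable [CompleteSpace E]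

open scoped WithCStarModule in
/-- The unitary `U_P : H → R(P) ⊕ R(P)^⊥`, `U_P h = (P h, (1 - P) h)`, of a projection `P`. -/
noncomputable def projUnitary (P : Adj A E E) (hP : IsStarProjection P) :
    Adj A E C⋆ᵐᵒᵈ(A, P.projRange hP × (P.projRange hP).orthogonal) :=
  ofPair
    (fun h => (WithCStarModule.equiv A _).symm
      (⟨P h, P.apply_mem_projRange hP h⟩, ⟨(1 - P) h, P.sub_apply_mem_orthogonal hP h⟩))
    (fun v => (v.1 : E) + (v.2 : E))
    (fun x v => by
      obtain ⟨⟨_, z, rfl⟩, w, hw⟩ := v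
      have h1 : inner A (P x) (P z) = inner A x (P z) := by
        rw [inner_left, ← star_eq_adjoint, hP.isSelfAdjoint.star_eq, ← mul_apply,
          hP.isIdempotentElem.eq]
      have h2 : inner A ((1 - P) x) w = inner A x w := by
        have h3 : inner A (P x) w = 0 := by
          rw [← CStarModule.star_inner, hw _ (P.apply_mem_projRange hP x), star_zero]
        rw [sub_apply, one_apply, CStarModule.inner_sub_left, h3, sub_zero]
      rw [CStarModule.inner_add_right]
      exact congrArg₂ (· + ·) h1 h2)

variable {M N : ClosedSub A E}

open scoped WithCStarModule in
/-- The operator on `M ⊕ N` given by the block matrix `[[a, b], [c, d]]`. -/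
noncomputable def fromBlocks (a : Adj A M M) (b : Adj A N M) (c : Adj A M N) (d : Adj A N N) :
    Adj A C⋆ᵐᵒᵈ(A, M × N) C⋆ᵐᵒᵈ(A, M × N) :=
  ofPair
    (fun v => (WithCStarModule.equiv A (M × N)).symm (a v.1 + b v.2, c v.1 + d v.2))
    (fun v => (WithCStarModule.equiv A (M × N)).symm
      (a.adjoint v.1 + c.adjoint v.2, b.adjoint v.1 + d.adjoint v.2))
    (fun v w => by
      simp only [WithCStarModule.prod_inner, WithCStarModule.equiv_symm_fst,
        WithCStarModule.equiv_symm_snd, CStarModule.inner_add_left, CStarModule.inner_add_right,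
        inner_left]
      abel)

/-- `U` is a partial isometry: `U* U` is a projection. -/
def IsPartialIsometry (U : Adj A E F) : Prop :=
  IsStarProjection (U.adjoint.comp U : Adj A E E)

end Adj
end Submodules

section QuasiProjectionPairs

/-- A quasi-projection pair `(P, Q)` on `E`. -/
structure QuasiProjectionPair (A E : Type*) [NonUnitalCStarAlgebra A] [PartialOrder A]
    [NormedAddCommGroup E] [NormedSpace ℂ E] [SMul A E] [CStarModule A E] where
  P : Adj A E E
  Q : Adj A E E
  isStarProjection : IsStarProjection P
  isIdempotentElem : IsIdempotentElem Q
  upper_left : P * star Q * P = P * Q * P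
  upper_right : P * star Q * (1 - P) = -(P * Q * (1 - P))
  lower_right : (1 - P) * star Q * (1 - P) = (1 - P) * Q * (1 - P)

variable {A E : Type*} [NonUnitalCStarAlgebra A] [PartialOrder A] [StarOrderedRing A]
  [NormedAddCommGroup E] [NormedSpace ℂ E] [SMul A E] [CStarModule A E]

/-- `(P, Q)` is harmonious: the closures of the ranges of `P Q (1 - P)` and `(1 - P) Q P` are
orthogonally complemented. -/
def QuasiProjectionPair.IsHarmonious (p : QuasiProjectionPair A E) : Prop :=
  (p.P * p.Q * (1 - p.P)).closedRange.IsOrthComplemented ∧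
  ((1 - p.P) * p.Q * p.P).closedRange.IsOrthComplemented

/-- The matched pair `(m(Q), Q)` of an idempotent `Q`. -/
noncomputable def matchedPair [CompleteSpace E] (Q : Adj A E E) (hQ : IsIdempotentElem Q) :
    QuasiProjectionPair A E where
  P := matchedProj Q
  Q := Q
  isStarProjection := matchedProj_isStarProjection hQ
  isIdempotentElem := hQ
  upper_left := by
    have h := (matchedProj_isStarProjection hQ).isIdempotentElem.eq
    have h1 : matchedProj Q * (2 * matchedProj Q - 1) = matchedProj Q := by
      rw [mul_sub, two_mul, mul_add, h, mul_one, add_sub_cancel_right]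
    have h2 : (2 * matchedProj Q - 1) * matchedProj Q = matchedProj Q := by
      rw [sub_mul, two_mul, add_mul, h, one_mul, add_sub_cancel_right]
    rw [star_eq_matchedProj hQ, ← mul_assoc, ← mul_assoc, h1, mul_assoc, h2]
  upper_right := by
    have h := (matchedProj_isStarProjection hQ).isIdempotentElem.eq
    have h1 : matchedProj Q * (2 * matchedProj Q - 1) = matchedProj Q := by
      rw [mul_sub, two_mul, mul_add, h, mul_one, add_sub_cancel_right]
    have h2 : (2 * matchedProj Q - 1) * (1 - matchedProj Q) = -(1 - matchedProj Q) := by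
      rw [mul_sub, mul_one, sub_mul, two_mul, add_mul, h, one_mul]; abel
    rw [star_eq_matchedProj hQ, ← mul_assoc, ← mul_assoc, h1, mul_assoc, h2, mul_neg]
  lower_right := by
    have h := (matchedProj_isStarProjection hQ).isIdempotentElem.eq
    have h1 : (1 - matchedProj Q) * (2 * matchedProj Q - 1) = -(1 - matchedProj Q) := by
      rw [sub_mul, one_mul, mul_sub, two_mul, mul_add, h, mul_one]; abel
    have h2 : (2 * matchedProj Q - 1) * (1 - matchedProj Q) = -(1 - matchedProj Q) := by
      rw [mul_sub, mul_one, sub_mul, two_mul, add_mul, h, one_mul]; abel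
    rw [star_eq_matchedProj hQ, ← mul_assoc, ← mul_assoc, h1, mul_assoc, h2, mul_neg, neg_mul,
      neg_mul, neg_neg]

/-- The range `R(m(Q))` of the matched projection. -/
noncomputable abbrev matchedRange [CompleteSpace E] (Q : Adj A E E) (hQ : IsIdempotentElem Q) :
    ClosedSub A E :=
  (matchedProj Q).projRange (matchedProj_isStarProjection hQ)

open scoped WithCStarModule in
/-- The unitary `U_{m(Q)} : H → R(m(Q)) ⊕ R(m(Q))^⊥`. -/
noncomputable abbrev matchedUnitary [CompleteSpace E] (Q : Adj A E E) (hQ : IsIdempotentElem Q) :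
    Adj A E C⋆ᵐᵒᵈ(A, matchedRange Q hQ × (matchedRange Q hQ).orthogonal) :=
  (matchedProj Q).projUnitary (matchedProj_isStarProjection hQ)

end QuasiProjectionPairs

end HilbertCStar

/-! Write `P = m(Q)`, `b = |Q*|` and `w = b + Q`. Since `w w* = 2 (b + 1) b`, the defining formula
reads `P = w* (w w*)† w`, so `P` is the projection onto `R(w*)`. Two facts about matched pairs
follow. The corner `T = PQP` satisfies `T ≥ 1` on `R(P)`, because `w (Q - 1) w* = (b + 1) b (b -
p)`, where `p = b b†` is the range projection of `Q` and `p ≤ b` (`matchedProj_le_compression`).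
Moreover `PQx = 0` forces `Qx = 0` (`exists_mul_matchedProj_mul_eq`).

Let `C` and `D` be the lower left and lower right corners of `Q`. The quasi-projection relations
make the upper right corner `-C*`. Then `Q² = Q` gives `C* C = T² - T` and `D C = C (1 - T)`. So `r
= T^(1/2) (T - 1)^(1/2)` is a square root of `C* C`, and a polar decomposition `C = U r` gives the
off-diagonal entries. In Hilbert modules it needs the closures of `R(C)` and `R(C*)` to be
complemented, which is harmony (`exists_polar`).

Finally `D = U (1 - T) U*`. On the closure of `R(C)` this is `D C = C (1 - T)`; on its complement
`ker C*` the operator `U*` vanishes, and so does `D` by the second fact. That fact is special to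
matched pairs: the quasi-projection pair `(0, 1)` has `C = 0` but `D = 1`. -/

namespace HilbertCStar

/-! ### Order and kernel properties of the matched projection. -/

section MatchedProjectionOrder

variable {B : Type*} [CStarAlgebra B] [PartialOrder B] [StarOrderedRing B]

/-- Factorization `m(q) = k (|q*| + q)` with the element
`k = (1/2) (|q*| + q*) |q*|† (|q*| + 1)⁻¹`, for which `k (|q*| + 1) |q*| = (|q*| + q*) / 2`. -/
theorem exists_matchedProj_eq_mul {q : B} (hq : IsIdempotentElem q) :
    ∃ k : B, matchedProj q = k * (CFC.abs (star q) + q) ∧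
      k * ((2 : ℂ) • ((CFC.abs (star q) + 1) * CFC.abs (star q))) = CFC.abs (star q) + star q := by
  obtain ⟨hmp, hsa, hcx, hbxq⟩ := moorePenrose_abs_star hq
  have hbs := star_abs (star q)
  have hunit := isUnit_abs_add_one (star q)
  refine ⟨(1 / 2 : ℂ) • ((CFC.abs (star q) + star q) * moorePenrose (CFC.abs (star q)) *
    Ring.inverse (CFC.abs (star q) + 1)), by rw [matchedProj, smul_mul_assoc], ?_⟩
  set b := CFC.abs (star q)
  set x := moorePenrose b
  have h1 : star q * (x * b) = star q := by
    have := congrArg star hbxq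
    rwa [star_mul, star_mul, hbs, hsa.star_eq] at this
  have h2 : b * (x * b) = b := by rw [← mul_assoc, hmp.mul_mul_left]
  rw [smul_mul_smul_comm, mul_assoc _ (Ring.inverse (b + 1)), ← mul_assoc (Ring.inverse (b + 1)),
    Ring.inverse_mul_cancel _ hunit, one_mul, mul_assoc, add_mul, h1, h2]
  norm_num

/-- This identifies the middle factor of `m(q)`: with `w = |q*| + q`, the element `(1/2) |q*|† (|q*|
+ 1)⁻¹` is the Moore-Penrose inverse of `w w*`. -/
theorem abs_star_add_mul_star {q : B} (hq : IsIdempotentElem q) :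
    (CFC.abs (star q) + q) * (CFC.abs (star q) + star q) =
      (2 : ℂ) • ((CFC.abs (star q) + 1) * CFC.abs (star q)) := by
  rw [add_mul, mul_add, mul_add, mul_abs_star hq, abs_star_mul_star hq, ← abs_mul_abs_star q,
    two_smul, add_mul, one_mul]
  abel

/-- As `m(q) = k w`, the factorization gives `m(q) w* = k w w* = w*`; take adjoints. -/
theorem abs_star_add_mul_matchedProj {q : B} (hq : IsIdempotentElem q) :
    (CFC.abs (star q) + q) * matchedProj q = CFC.abs (star q) + q := by
  obtain ⟨k, hk, hk'⟩ := exists_matchedProj_eq_mul hq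
  have h : matchedProj q * (CFC.abs (star q) + star q) = CFC.abs (star q) + star q := by
    rw [hk, mul_assoc, abs_star_add_mul_star hq, hk']
  have := congrArg star h
  rwa [star_mul, (matchedProj_isStarProjection hq).isSelfAdjoint.star_eq, star_add, star_star,
    star_abs] at this

/-- An idempotent `q` is a left multiple of `m(q) q`. -/
theorem exists_mul_matchedProj_mul_eq {q : B} (hq : IsIdempotentElem q) :
    ∃ y : B, y * (matchedProj q * q) = q := by
  -- With `w = |q*| + q` one has `w m(q) q = w q = (|q*| + 1) q`, and `|q*| + 1` is invertible.
  refine ⟨Ring.inverse (CFC.abs (star q) + 1) * (CFC.abs (star q) + q), ?_⟩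
  rw [mul_assoc, ← mul_assoc (CFC.abs (star q) + q), abs_star_add_mul_matchedProj hq,
    show (CFC.abs (star q) + q) * q = (CFC.abs (star q) + 1) * q by
      rw [add_mul, add_mul, hq.eq, one_mul], ← mul_assoc, Ring.inverse_mul_cancel _ (isUnit_abs_add_one _), one_mul]

/-- `|q*| ≥ p`, where `p = |q*| |q*|†` is the range projection of `q`. -/
theorem mul_moorePenrose_le_abs_star {q : B} (hq : IsIdempotentElem q) :
    CFC.abs (star q) * moorePenrose (CFC.abs (star q)) ≤ CFC.abs (star q) := by
  obtain ⟨hmp, hsa, hcx, hbxq⟩ := moorePenrose_abs_star hq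
  have hqb := mul_abs_star hq
  have hbb := abs_mul_abs_star q
  have hb0 : 0 ≤ CFC.abs (star q) := CFC.abs_nonneg _
  set b := CFC.abs (star q)
  set x := moorePenrose b
  have hp : IsStarProjection (b * x) :=
    ⟨by rw [IsIdempotentElem, ← mul_assoc, hmp.mul_mul_left], hmp.star_left⟩
  -- As `q p = p` for `p = b x`, conjugating `1 - p ≥ 0` by `q` gives `p ≤ q q* = b²`.
  have h1 : q * (1 - b * x) * star q = b * b - b * x := by
    have h2 : b * x * star q = b * x := by
      have := congrArg star (show q * (b * x) = b * x by rw [← mul_assoc, hqb])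
      rwa [star_mul, hmp.star_left] at this
    rw [mul_sub, mul_one, ← mul_assoc, hqb, sub_mul, hbb, h2]
  have h3 : b * x ≤ b * b := by
    rw [← sub_nonneg, ← h1]
    exact star_right_conjugate_nonneg hp.one_sub.nonneg q
  -- The square root is operator monotone, and the projection `p` is its own square root.
  have h4 := CFC.sqrt_le_sqrt _ _ h3
  rwa [CFC.sqrt_mul_self b hb0, ← hp.isIdempotentElem.eq,
    CFC.sqrt_mul_self _ hp.nonneg] at h4

/-- The compression of an idempotent `q` to `m(q)` is at least `m(q)`. -/
theorem matchedProj_le_compression {q : B} (hq : IsIdempotentElem q) :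
    matchedProj q ≤ matchedProj q * q * matchedProj q := by
  obtain ⟨hmp, hsa, hcx, hbxq⟩ := moorePenrose_abs_star hq
  obtain ⟨k, hk, -⟩ := exists_matchedProj_eq_mul hq
  have hP := matchedProj_isStarProjection hq
  have hle := mul_moorePenrose_le_abs_star hq
  have hb0 : 0 ≤ CFC.abs (star q) := CFC.abs_nonneg _
  have hqb := mul_abs_star hq
  have hbb := abs_mul_abs_star q
  have hww := abs_star_add_mul_star hq
  have hbs := star_abs (star q)
  set b := CFC.abs (star q)
  set x := moorePenrose b
  have hk' : matchedProj q = (b + star q) * star k := by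
    have := congrArg star hk
    rwa [hP.isSelfAdjoint.star_eq, star_mul, star_add, hbs] at this
  -- The right side is a product of commuting positive elements, by `b x ≤ b`. Conjugating it by `k`
  -- yields `m(q) q m(q) - m(q)`.
  have hmid : (b + q) * (q - 1) * (b + star q) = (b + 1) * (b * (b - b * x)) := by
    have e1 : (b + q) * q = (b + 1) * q := by rw [add_mul, add_mul, hq.eq, one_mul]
    have e2 : b * (b * x) = b := by rw [hcx.eq, ← mul_assoc, hmp.mul_mul_left]
    rw [mul_sub, mul_one, sub_mul, hww, e1, mul_assoc, mul_add, hqb, ← hbb, mul_sub b b, e2,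
      two_smul]
    noncomm_ring
  have hcomm : Commute b (b - b * x) :=
    (Commute.refl b).sub_right ((Commute.refl b).mul_right hcx)
  have h0 : 0 ≤ b * (b - b * x) := hcomm.mul_nonneg hb0 (sub_nonneg.2 hle)
  have h1 : 0 ≤ (b + 1) * (b * (b - b * x)) := by
    refine Commute.mul_nonneg (add_nonneg hb0 zero_le_one) h0 ?_
    exact (((Commute.refl b).mul_right hcomm).add_left (Commute.one_left _))
  have h2 : matchedProj q * q * matchedProj q - matchedProj q =
      k * ((b + 1) * (b * (b - b * x))) * star k := by
    rw [← hmid]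
    calc _ = matchedProj q * (q - 1) * matchedProj q := by
          rw [mul_sub, mul_one, sub_mul, hP.isIdempotentElem.eq]
      _ = k * (b + q) * (q - 1) * ((b + star q) * star k) := by rw [← hk, ← hk']
      _ = _ := by simp only [mul_assoc]
  rw [← sub_nonneg, h2]
  exact star_right_conjugate_nonneg h1 k

end MatchedProjectionOrder
-- Partial isometries and polar decomposition between Hilbert modules.
section PolarDecomposition

variable {A E F G : Type*} [NonUnitalCStarAlgebra A] [PartialOrder A]
  [NormedAddCommGroup E] [NormedSpace ℂ E] [SMul A E] [CStarModule A E]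
  [NormedAddCommGroup F] [NormedSpace ℂ F] [SMul A F] [CStarModule A F]
  [NormedAddCommGroup G] [NormedSpace ℂ G] [SMul A G] [CStarModule A G]

namespace Adj

theorem adjoint_comp (T : Adj A F G) (S : Adj A E F) :
    (T.comp S).adjoint = S.adjoint.comp T.adjoint :=
  adjoint_eq _ _ fun x y => by simp [inner_left]

theorem continuous_apply (T : Adj A E F) : Continuous T := T.toCLM.continuous

theorem eqOn_closure_range (S T : Adj A F G) (R : Adj A E F) (h : ∀ x, S (R x) = T (R x))
    {y : F} (hy : y ∈ closure (Set.range R)) : S y = T y := by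
  have : Set.EqOn S T (Set.range R) := by rintro _ ⟨x, rfl⟩; exact h x
  exact this.closure S.continuous_apply T.continuous_apply hy

variable [StarOrderedRing A]

/-- Passing to limits in `⟨R x, y⟩ = ⟨S x, z⟩`. -/
theorem inner_eq_of_mem_closure {H : Type*} [NormedAddCommGroup H] [NormedSpace ℂ H] [SMul A H]
    [CStarModule A H] (R : Adj A E F) (S : Adj A E H) {y : F} {z : H}
    (h : ∀ x, inner A (R x) y = inner A (S x) z) {u : F × H}
    (hu : u ∈ closure (Set.range fun x => (R x, S x))) : inner A u.1 y = inner A u.2 z := by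
  have hc : IsClosed {u : F × H | inner A u.1 y = inner A u.2 z} :=
    isClosed_eq
      ((CStarModule.continuous_inner (A := A) (E := F)).comp
        (continuous_fst.prodMk continuous_const))
      ((CStarModule.continuous_inner (A := A) (E := H)).comp
        (continuous_snd.prodMk continuous_const))
  refine closure_minimal ?_ hc hu
  rintro _ ⟨x, rfl⟩
  exact h x

theorem inner_eq_zero_of_mem_closure (R : Adj A E F) {y : F} (h : R.adjoint y = 0) {u : F}
    (hu : u ∈ closure (Set.range R)) : inner A u y = 0 := by
  have hc : IsClosed {u : F | inner A u y = 0} :=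
    isClosed_eq
      ((CStarModule.continuous_inner (A := A) (E := F)).comp
        (continuous_id.prodMk continuous_const)) continuous_const
  refine closure_minimal ?_ hc hu
  rintro _ ⟨x, rfl⟩
  simp [inner_left, h]

theorem norm_eq_of_adjoint_comp_eq {R : Adj A E F} {S : Adj A E G}
    (h : R.adjoint.comp R = S.adjoint.comp S) (x : E) : ‖R x‖ = ‖S x‖ := by
  have h1 : R.adjoint (R x) = S.adjoint (S x) := DFunLike.congr_fun h x
  rw [CStarModule.norm_eq_sqrt_norm_inner_self (A := A) (R x),
    CStarModule.norm_eq_sqrt_norm_inner_self (A := A) (S x), inner_left, inner_left, h1]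

/-- The isometry `R x ↦ S x` extends to the closure of the range of `R`. -/
theorem exists_mem_closure_graph [CompleteSpace G] {R : Adj A E F} {S : Adj A E G}
    (h : R.adjoint.comp R = S.adjoint.comp S) {y : F} (hy : y ∈ closure (Set.range R)) :
    ∃ z, (y, z) ∈ closure (Set.range fun x => (R x, S x)) := by
  obtain ⟨u, hu, hlim⟩ := mem_closure_iff_seq_limit.1 hy
  choose v hv using hu
  obtain rfl : (fun n => R (v n)) = u := funext hv
  have hcs : CauchySeq fun n => S (v n) := by
    have := hlim.cauchySeq
    rw [Metric.cauchySeq_iff'] at this ⊢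
    have e : ∀ m n, dist (S (v m)) (S (v n)) = dist (R (v m)) (R (v n)) := fun m n => by
      rw [dist_eq_norm, dist_eq_norm, ← map_sub, ← map_sub, norm_eq_of_adjoint_comp_eq h]
    simpa only [e] using this
  obtain ⟨z, hz⟩ := cauchySeq_tendsto_of_complete hcs
  exact ⟨z, mem_closure_of_tendsto (hlim.prodMk_nhds hz) (.of_forall fun n => ⟨v n, rfl⟩)⟩

theorem fst_mem_closure {R : Adj A E F} {S : Adj A E G} {u : F × G}
    (hu : u ∈ closure (Set.range fun x => (R x, S x))) : u.1 ∈ closure (Set.range R) :=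
  map_mem_closure continuous_fst hu (by rintro _ ⟨x, rfl⟩; exact ⟨x, rfl⟩)

theorem snd_mem_closure {R : Adj A E F} {S : Adj A E G} {u : F × G}
    (hu : u ∈ closure (Set.range fun x => (R x, S x))) : u.2 ∈ closure (Set.range S) :=
  map_mem_closure continuous_snd hu (by rintro _ ⟨x, rfl⟩; exact ⟨x, rfl⟩)

theorem mem_closure_graph_swap {R : Adj A E F} {S : Adj A E G} {y : F} {z : G}
    (hu : (z, y) ∈ closure (Set.range fun x => (S x, R x))) :
    (y, z) ∈ closure (Set.range fun x => (R x, S x)) :=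
  by
  have := map_mem_closure (t := Set.range fun x => (R x, S x)) continuous_swap hu
    (by rintro _ ⟨x, rfl⟩; exact ⟨x, rfl⟩)
  exact this

/-- If `R* R = S* S`, and the closures of the ranges of `R` and `S` are orthogonally complemented,
then `S = U R` for a partial isometry `U` with `R(U*)` the closure of `R(R)`. -/
theorem exists_partialIsometry [CompleteSpace F] [CompleteSpace G]
    {R : Adj A E F} {S : Adj A E G} (h : R.adjoint.comp R = S.adjoint.comp S)
    (hR : ∀ x, ∃ y ∈ closure (Set.range R), R.adjoint (x - y) = 0)
    (hS : ∀ x, ∃ y ∈ closure (Set.range S), S.adjoint (x - y) = 0) :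
    ∃ U : Adj A F G, U.IsPartialIsometry ∧ Set.range U.adjoint = closure (Set.range R) ∧
      U.comp R = S ∧ U.adjoint.comp S = R := by
  -- The functions `m` and `n` play the role of the orthogonal projections onto the two closed
  -- ranges; `f` and `g` follow them by the extended isometry `R x ↦ S x` and by its inverse. They
  -- are arbitrary choices: linearity and continuity come later, from `f` and `g` being mutually
  -- adjoint.
  choose m hm hm' using hR
  choose n hn hn' using hS
  have h1 := fun x => exists_mem_closure_graph h (hm x)
  have h2 := fun y => exists_mem_closure_graph h.symm (hn y)
  choose f hf using h1
  choose g hg using h2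
  replace hg := fun y => mem_closure_graph_swap (hg y)
  have hinner : ∀ {u v : F × G}, u ∈ closure (Set.range fun x => (R x, S x)) →
      v ∈ closure (Set.range fun x => (R x, S x)) → inner A u.1 v.1 = inner A u.2 v.2 := by
    intro u v hu hv
    refine inner_eq_of_mem_closure R S (fun x => ?_) hu
    rw [← CStarModule.star_inner v.1 (R x), ← CStarModule.star_inner v.2 (S x)]
    congr 1
    refine inner_eq_of_mem_closure R S (fun z => ?_) hv
    have h3 : R.adjoint (R x) = S.adjoint (S x) := DFunLike.congr_fun h x
    rw [inner_left, inner_left, h3]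
  -- `y - n y` is orthogonal to the closure of `R(S)`, so `y` may be replaced by `n y`, which the
  -- isometry pairs with `g y`.
  have hleft : ∀ u ∈ closure (Set.range fun x => (R x, S x)), ∀ y,
      inner A u.2 y = inner A u.1 (g y) := fun u hu y => by
    have e := inner_eq_zero_of_mem_closure S (hn' y) (snd_mem_closure hu)
    rw [CStarModule.inner_sub_right, sub_eq_zero] at e
    rw [e, hinner hu (hg y)]
  have hright : ∀ u ∈ closure (Set.range fun x => (R x, S x)), ∀ y,
      inner A u.1 y = inner A u.2 (f y) := fun u hu y => by
    have e := inner_eq_zero_of_mem_closure R (hm' y) (fst_mem_closure hu)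
    rw [CStarModule.inner_sub_right, sub_eq_zero] at e
    rw [e, hinner hu (hf y)]
  have hadj : ∀ x y, inner A (f x) y = inner A x (g y) := fun x y => by
    rw [hleft _ (hf x) y, ← CStarModule.star_inner (g y) (m x), ← CStarModule.star_inner (g y) x]
    congr 1
    have e := hright _ (hg y) x
    rw [hinner (hg y) (hf x)]
    exact e.symm
  set U : Adj A F G := ofPair f g hadj
  have hUf : ∀ x, U x = f x := ofPair_apply f g hadj
  have hUg : ∀ y, U.adjoint y = g y := adjoint_ofPair_apply f g hadj
  have hmem : ∀ x, (R x, S x) ∈ closure (Set.range fun x => (R x, S x)) :=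
    fun x => subset_closure ⟨x, rfl⟩
  have hUR : ∀ x, U (R x) = S x := fun x => ext_inner_left (A := A) fun y => by
    rw [inner_left, hUg, hleft _ (hmem x) y]
  have hUS : ∀ x, U.adjoint (S x) = R x := fun x => ext_inner_left (A := A) fun y => by
    rw [inner_left, adjoint_adjoint, hUf, hright _ (hmem x) y]
  have hUU : ∀ y ∈ closure (Set.range S), U (U.adjoint y) = y := fun y hy =>
    eqOn_closure_range (U.comp U.adjoint) 1 S (fun x => by simp [hUS, hUR]) hy
  have hUU' : ∀ y ∈ closure (Set.range R), U.adjoint (U y) = y := fun y hy =>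
    eqOn_closure_range (U.adjoint.comp U) 1 R (fun x => by simp [hUS, hUR]) hy
  refine ⟨U, ⟨?_, ?_⟩, ?_, ext hUR, ext hUS⟩
  · refine ext fun x => ?_
    rw [mul_apply, comp_apply, comp_apply]
    congr 1
    exact hUU _ (by rw [hUf]; exact snd_mem_closure (hf x))
  · rw [isSelfAdjoint_iff, star_eq_adjoint, adjoint_comp, adjoint_adjoint]
  · refine Set.Subset.antisymm ?_ fun y hy => ⟨U y, hUU' y hy⟩
    rintro _ ⟨y, rfl⟩
    rw [hUg]
    exact fst_mem_closure (hg y)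

/-- If the closure of `R(T)` is orthogonally complemented, `R(T* T)` is dense in `R(T*)`. -/
theorem closure_range_adjoint_comp (T : Adj A E F)
    (h : ∀ x, ∃ y ∈ closure (Set.range T), T.adjoint (x - y) = 0) :
    closure (Set.range (T.adjoint.comp T)) = closure (Set.range T.adjoint) := by
  refine Set.Subset.antisymm
    (closure_mono (by rintro _ ⟨x, rfl⟩; exact ⟨T x, rfl⟩))
    (closure_minimal ?_ isClosed_closure)
  -- `T* x = T* y` with `y` a limit of vectors `T z`, hence `T* x` is a limit of `T* T z`.
  rintro _ ⟨x, rfl⟩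
  obtain ⟨y, hy, hxy⟩ := h x
  rw [map_sub, sub_eq_zero] at hxy
  rw [hxy]
  refine map_mem_closure T.adjoint.continuous_apply hy ?_
  rintro _ ⟨z, rfl⟩
  exact ⟨z, rfl⟩

/-- Polar decomposition `T = U r` with respect to a self-adjoint square root `r` of `T* T`. -/
theorem exists_polar [CompleteSpace E] [CompleteSpace F] {T : Adj A E F} {r : Adj A E E}
    (hr : IsSelfAdjoint r) (h : r * r = T.adjoint.comp T)
    (hT : ∀ x, ∃ y ∈ closure (Set.range T), T.adjoint (x - y) = 0)
    (hT' : ∀ x, ∃ y ∈ closure (Set.range T.adjoint), T (x - y) = 0) :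
    ∃ U : Adj A E F, U.IsPartialIsometry ∧
      Set.range U.adjoint = closure (Set.range T.adjoint) ∧ U.comp r = T ∧
      U.adjoint.comp T = r ∧
      closure (Set.range r) = closure (Set.range T.adjoint) := by
  have hr' : r.adjoint = r := hr.star_eq
  have hrr : r.adjoint.comp r = T.adjoint.comp T := by rw [hr']; exact h
  have hcl := closure_range_adjoint_comp T hT
  have hker : ∀ x, T x = 0 → r x = 0 := fun x hx => by
    rw [← norm_eq_zero, norm_eq_of_adjoint_comp_eq hrr, hx, norm_zero]
  have hsub : closure (Set.range T.adjoint) ⊆ closure (Set.range r) := by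
    rw [← hcl, ← h]
    exact closure_mono (by rintro _ ⟨x, rfl⟩; exact ⟨r x, rfl⟩)
  -- `T` and `r` have the same kernel, so `r x = r y` with `y` in the closure of `R(T*)`, which
  -- equals that of `R(r²)`; and `r (r² z) = r² (r z)`. Thus complementedness passes from `R(T*)` to
  -- `R(r)`.
  have hrange : closure (Set.range r) = closure (Set.range T.adjoint) := by
    refine Set.Subset.antisymm (closure_minimal ?_ isClosed_closure) hsub
    rintro _ ⟨x, rfl⟩
    obtain ⟨y, hy, hxy⟩ := hT' x
    have hxy' := hker _ hxy
    rw [map_sub, sub_eq_zero] at hxy'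
    rw [hxy', ← hcl]
    rw [← hcl, ← h] at hy
    refine map_mem_closure r.continuous_apply hy ?_
    rintro _ ⟨z, rfl⟩
    exact ⟨r z, by rw [← h]; rfl⟩
  obtain ⟨U, hU1, hU2, hU3, hU4⟩ := exists_partialIsometry hrr
    (fun x => by
      obtain ⟨y, hy, hxy⟩ := hT' x
      exact ⟨y, hsub hy, by rw [hr']; exact hker _ hxy⟩) hT
  exact ⟨U, hU1, hU2.trans hrange, hU3, hU4, hrange⟩

/-- If `K = V T W*` with isometries `V` and `W`, and the closure of `R(K)` is orthogonally
complemented, then so is the closure of `R(T)`. -/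
theorem exists_mem_closure_of_isOrthComplemented {H : Type*} [NormedAddCommGroup H]
    [NormedSpace ℂ H] [SMul A H] [CStarModule A H] {T : Adj A G F} {V : Adj A F E} {W : Adj A G H}
    {K : Adj A H E} (hV : ∀ x, V.adjoint (V x) = x) (hW : ∀ x, W.adjoint (W x) = x)
    (hK : ∀ x, K x = V (T (W.adjoint x))) (h : K.closedRange.IsOrthComplemented) (x : F) :
    ∃ y ∈ closure (Set.range T), T.adjoint (x - y) = 0 := by
  obtain ⟨y, hy, z, hz, hyz⟩ := h (V x)
  -- The orthogonal complement of `R(K)` is `ker K*`.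
  have hKz : K.adjoint z = 0 := ext_inner_left (A := A) fun u => by
    have h0 : inner A z (K u) = 0 := hz _ (subset_closure ⟨u, rfl⟩)
    rw [← inner_right, h0, CStarModule.inner_zero_left]
  refine ⟨V.adjoint y, ?_, ?_⟩
  · refine map_mem_closure V.adjoint.continuous_apply hy ?_
    rintro _ ⟨u, rfl⟩
    exact ⟨W.adjoint u, by rw [← hV (T _), ← hK]; rfl⟩
  · have e : x - V.adjoint y = V.adjoint z := by
      rw [← hV x, ← map_sub, hyz, add_sub_cancel_left]
    have hK' : K = V.comp (T.comp W.adjoint) := ext hK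
    -- `W* W = 1` makes `W` injective, so `K* z = W T* V* z = 0` gives `T* V* z = 0`.
    rw [e, ← hW (T.adjoint _)]
    have : K.adjoint z = W (T.adjoint (V.adjoint z)) := by
      rw [hK', adjoint_comp, adjoint_comp, adjoint_adjoint]; rfl
    rw [← this, hKz, map_zero]

end Adj

end PolarDecomposition
-- Block matrices with respect to a projection.
section Blocks

variable {A E : Type*} [NonUnitalCStarAlgebra A] [PartialOrder A] [StarOrderedRing A]
  [NormedAddCommGroup E] [NormedSpace ℂ E] [SMul A E] [CStarModule A E] [CompleteSpace E]

namespace Adj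

/-- The inclusion of the range of a projection. -/
noncomputable def rangeIncl (P : Adj A E E) (hP : IsStarProjection P) :
    Adj A (P.projRange hP) E :=
  ofPair (fun x => x.1) (fun x => ⟨P x, P.apply_mem_projRange hP x⟩) (fun x y => by
    obtain ⟨_, z, rfl⟩ := x
    change inner A (P z) y = inner A (P z) (P y)
    rw [inner_right, ← star_eq_adjoint, hP.isSelfAdjoint.star_eq, ← mul_apply,
      hP.isIdempotentElem.eq])

/-- The inclusion of the orthogonal complement of the range of a projection. -/
noncomputable def orthogonalIncl (P : Adj A E E) (hP : IsStarProjection P) :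
    Adj A (P.projRange hP).orthogonal E :=
  ofPair (fun x => x.1) (fun x => ⟨(1 - P) x, P.sub_apply_mem_orthogonal hP x⟩) (fun x y => by
    change inner A x.1 y = inner A x.1 ((1 - P) y)
    rw [sub_apply, one_apply, CStarModule.inner_sub_right,
      x.2 _ (P.apply_mem_projRange hP y), sub_zero])

variable {P : Adj A E E} {hP : IsStarProjection P}

@[simp] theorem rangeIncl_apply (x : P.projRange hP) : P.rangeIncl hP x = x :=
  ofPair_apply _ _ _ _

@[simp] theorem coe_adjoint_rangeIncl_apply (x : E) :
    (((P.rangeIncl hP).adjoint x : P.projRange hP) : E) = P x :=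
  congrArg Subtype.val (adjoint_ofPair_apply _ _ _ x)

@[simp] theorem orthogonalIncl_apply (x : (P.projRange hP).orthogonal) :
    P.orthogonalIncl hP x = x :=
  ofPair_apply _ _ _ _

@[simp] theorem coe_adjoint_orthogonalIncl_apply (x : E) :
    (((P.orthogonalIncl hP).adjoint x : (P.projRange hP).orthogonal) : E) = (1 - P) x :=
  congrArg Subtype.val (adjoint_ofPair_apply _ _ _ x)

theorem apply_coe_projRange (x : P.projRange hP) : P (x : E) = x := by
  obtain ⟨_, y, rfl⟩ := x
  exact DFunLike.congr_fun hP.isIdempotentElem.eq y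

theorem apply_coe_orthogonal (x : (P.projRange hP).orthogonal) : P (x : E) = 0 := by
  refine ext_inner_left (A := A) fun z => ?_
  rw [inner_left, ← star_eq_adjoint, hP.isSelfAdjoint.star_eq,
    x.2 _ (P.apply_mem_projRange hP z), CStarModule.inner_zero_left]

theorem adjoint_rangeIncl_rangeIncl (x : P.projRange hP) :
    (P.rangeIncl hP).adjoint (P.rangeIncl hP x) = x :=
  Subtype.ext (by simp [apply_coe_projRange])

theorem adjoint_orthogonalIncl_orthogonalIncl (x : (P.projRange hP).orthogonal) :
    (P.orthogonalIncl hP).adjoint (P.orthogonalIncl hP x) = x :=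
  Subtype.ext (by simp [apply_coe_orthogonal])

/-- Compression to the range of `P` of `S` with `P ≤ P S P` is at least the identity. -/
theorem one_le_compression {S : Adj A E E} (h : P ≤ P * S * P) :
    1 ≤ (P.rangeIncl hP).adjoint.comp (S.comp (P.rangeIncl hP)) := by
  have hPP := hP.isIdempotentElem.eq
  have h0 : 0 ≤ P * S * P - P := sub_nonneg.2 h
  set D := P * S * P - P with hD
  set s := CFC.sqrt D with hs
  have hs0 : 0 ≤ s := CFC.sqrt_nonneg _
  have hss : s * s = D := CFC.sqrt_mul_sqrt_self D h0
  have hDP : D * P = D := by rw [hD, sub_mul, mul_assoc (P * S), hPP]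
  -- `s` lives in the corner of `P`, so compressing it to `R(P)` loses nothing and the compression
  -- of `s²` is the square of that of `s`. This presents the difference as `g* g` inside the algebra
  -- on `R(P)`.
  have hsP : s * (1 - P) = 0 := by
    rw [← CStarRing.star_mul_self_eq_zero_iff, star_mul, hs0.isSelfAdjoint.star_eq, mul_assoc,
      ← mul_assoc s, hss, mul_sub, mul_one, hDP, sub_self, mul_zero]
  have hPs : P * s = s := by
    have := congrArg star hsP
    rw [star_mul, hs0.isSelfAdjoint.star_eq, star_zero, star_sub, star_one,
      hP.isSelfAdjoint.star_eq, sub_mul, one_mul, sub_eq_zero] at this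
    exact this.symm
  set g := (P.rangeIncl hP).adjoint.comp (s.comp (P.rangeIncl hP)) with hg
  have hgs : star g = g := by
    rw [hg, star_eq_adjoint, adjoint_comp, adjoint_comp, adjoint_adjoint, ← star_eq_adjoint s,
      hs0.isSelfAdjoint.star_eq]
    rfl
  have hgg : (P.rangeIncl hP).adjoint.comp (S.comp (P.rangeIncl hP)) - 1 = star g * g := by
    refine ext fun x => Subtype.ext ?_
    have h1 : P (s (P (s x))) = s (s (x : E)) := by
      simp only [← mul_apply, ← mul_assoc]
      rw [hPs, mul_assoc, hPs]
    have h2 : s (s (x : E)) = P (S (P (x : E))) - P (x : E) := DFunLike.congr_fun hss (x : E)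
    rw [hgs, mul_apply, sub_apply, ClosedSub.coe_sub]
    simp only [hg, comp_apply, rangeIncl_apply, coe_adjoint_rangeIncl_apply, one_apply]
    rw [h1, h2, apply_coe_projRange]
  rw [← sub_nonneg, hgg]
  exact star_mul_self_nonneg g

/-- The unitary has components `ι*` and `κ*`, where `ι` and `κ` are the two inclusions, and its
adjoint adds the two components. -/
theorem projUnitary_conj_eq_fromBlocks (Q : Adj A E E) :
    ((P.projUnitary hP).comp Q).comp (P.projUnitary hP).adjoint =
      fromBlocks ((P.rangeIncl hP).adjoint.comp (Q.comp (P.rangeIncl hP)))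
        ((P.rangeIncl hP).adjoint.comp (Q.comp (P.orthogonalIncl hP)))
        ((P.orthogonalIncl hP).adjoint.comp (Q.comp (P.rangeIncl hP)))
        ((P.orthogonalIncl hP).adjoint.comp (Q.comp (P.orthogonalIncl hP))) := by
  refine ext fun v => ?_
  rw [comp_apply, comp_apply]
  simp only [projUnitary, fromBlocks, adjoint_ofPair_apply, ofPair_apply]
  congr 1
  refine Prod.ext (Subtype.ext ?_) (Subtype.ext ?_)
  · simp [map_add]
  · simp [map_add]

end Adj
end Blocks
end HilbertCStar

/-! ### The block matrix of `Q` with respect to `m(Q)`. -/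

open HilbertCStar HilbertCStar.Adj in
theorem mainTheorem6 {A E : Type*} [NonUnitalCStarAlgebra A] [PartialOrder A] [StarOrderedRing A]
    [NormedAddCommGroup E] [NormedSpace ℂ E] [SMul A E] [CStarModule A E] [CompleteSpace E]
    (Q : HilbertCStar.Adj A E E) (hQ : IsIdempotentElem Q) (hQ' : ¬ IsStarProjection Q)
    (hharm : (HilbertCStar.matchedPair Q hQ).IsHarmonious) :
    ∃ (T : HilbertCStar.Adj A (HilbertCStar.matchedRange Q hQ) (HilbertCStar.matchedRange Q hQ))
      (U : HilbertCStar.Adj A (HilbertCStar.matchedRange Q hQ)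
        (HilbertCStar.matchedRange Q hQ).orthogonal),
      0 ≤ T ∧ 1 ≤ T ∧ U.IsPartialIsometry ∧
      Set.range ⇑U.adjoint = closure (Set.range ⇑(T - 1)) ∧
      ((HilbertCStar.matchedUnitary Q hQ).comp Q).comp (HilbertCStar.matchedUnitary Q hQ).adjoint =
        HilbertCStar.Adj.fromBlocks
          T
          (-((CFC.sqrt T * CFC.sqrt (T - 1)).comp U.adjoint))
          (U.comp (CFC.sqrt T * CFC.sqrt (T - 1)))
          ((U.comp (1 - T)).comp U.adjoint) := by
  have hP := matchedProj_isStarProjection hQ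
  rw [projUnitary_conj_eq_fromBlocks]
  set P := matchedProj Q
  set ι := P.rangeIncl hP
  set κ := P.orthogonalIncl hP
  set T := ι.adjoint.comp (Q.comp ι)
  set C := κ.adjoint.comp (Q.comp ι) with hC
  have hT1 : 1 ≤ T := one_le_compression (matchedProj_le_compression hQ)
  have hT0 : 0 ≤ T := zero_le_one.trans hT1
  have hQQ : ∀ x, Q (Q x) = Q x := fun x => DFunLike.congr_fun hQ.eq x
  have hB : ι.adjoint.comp (Q.comp κ) = -C.adjoint := by
    have h1 : C.adjoint = ι.adjoint.comp (Q.adjoint.comp κ) := by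
      rw [hC, adjoint_comp, adjoint_comp, adjoint_adjoint]; rfl
    refine ext fun v => Subtype.ext ?_
    have h2 := DFunLike.congr_fun (matchedPair Q hQ).upper_right (v : E)
    have h3 : (1 - P) (v : E) = v := by rw [Adj.sub_apply, apply_coe_orthogonal, one_apply, sub_zero]
    change P (Q.adjoint ((1 - P) (v : E))) = -(P (Q ((1 - P) (v : E)))) at h2
    rw [h3] at h2
    rw [h1]
    change _ = -(((ι.adjoint.comp (Q.adjoint.comp κ)) v : P.projRange hP) : E)
    simp only [ι, κ, comp_apply, coe_adjoint_rangeIncl_apply, orthogonalIncl_apply]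
    rw [h2, neg_neg]
  have hBv : ∀ v, ι.adjoint (Q (κ v)) = -(C.adjoint v) := fun v => DFunLike.congr_fun hB v
  have hsum : ∀ x : E, ι (ι.adjoint x) + κ (κ.adjoint x) = x := fun x => by
    simp [ι, κ]
  have hdecomp : ∀ x, Q (ι x) = ι (T x) + κ (C x) := fun x => (hsum _).symm
  -- Upper left corner of `Q² = Q`: `T² - C* C = T`.
  have hTT : C.adjoint.comp C = T * T - T := by
    refine ext fun x => ?_
    have h1 : ι.adjoint (Q (Q (ι x))) = T x := by rw [hQQ]; rfl
    rw [hdecomp, map_add, map_add, hBv] at h1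
    rw [comp_apply, Adj.sub_apply, ← h1]
    change _ = T (T x) - (T (T x) + -(C.adjoint (C x)))
    abel
  set D := κ.adjoint.comp (Q.comp κ)
  -- Lower left corner of `Q² = Q`: `C T + D C = C`.
  have hDC : ∀ x, D (C x) = C x - C (T x) := fun x => by
    have h1 : κ.adjoint (Q (Q (ι x))) = C x := by rw [hQQ]; rfl
    rw [hdecomp, map_add, map_add] at h1
    exact eq_sub_of_add_eq' h1
  -- For `v` in `R(P)^⊥`, `C* v = -P Q v`; and `Q` is a left multiple of `P Q` for the matched
  -- projection.
  have hD0 : ∀ v, C.adjoint v = 0 → D v = 0 := fun v hv => by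
    obtain ⟨y, hy⟩ := exists_mul_matchedProj_mul_eq hQ
    have h1 : P (Q (κ v)) = 0 := by
      rw [← coe_adjoint_rangeIncl_apply (hP := hP), hBv, hv, neg_zero]; rfl
    have h2 : Q (κ v) = 0 := by
      rw [← hy]
      change y (P (Q (κ v))) = 0
      rw [h1, map_zero]
    change κ.adjoint (Q (κ v)) = 0
    rw [h2, map_zero]
  have hcC : ∀ v, ∃ y ∈ closure (Set.range C), C.adjoint (v - y) = 0 :=
    exists_mem_closure_of_isOrthComplemented adjoint_orthogonalIncl_orthogonalIncl
      adjoint_rangeIncl_rangeIncl (fun x => by simp [hC, ι, κ]; rfl) hharm.2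
  -- The other half of harmony concerns `-C*`; the sign changes neither range nor kernel.
  have hcC' : ∀ x, ∃ y ∈ closure (Set.range C.adjoint), C (x - y) = 0 := fun x => by
    obtain ⟨y, hy, hxy⟩ := exists_mem_closure_of_isOrthComplemented
      (T := ι.adjoint.comp (Q.comp κ)) adjoint_rangeIncl_rangeIncl
      adjoint_orthogonalIncl_orthogonalIncl (fun x => by simp [ι, κ]; rfl) hharm.1 x
    rw [hB] at hy hxy
    refine ⟨y, closure_mono ?_ hy, ?_⟩
    · rintro _ ⟨v, rfl⟩
      exact ⟨-v, map_neg _ v⟩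
    · have h1 : (-C.adjoint).adjoint = -C := by
        refine adjoint_eq _ _ fun u w => ?_
        simp [inner_left]
      rw [h1] at hxy
      exact neg_eq_zero.1 hxy
  have hT1' : 0 ≤ T - 1 := sub_nonneg.2 hT1
  have hcomm : Commute (CFC.sqrt T) (CFC.sqrt (T - 1)) :=
    (((Commute.refl T).sub_right (Commute.one_right T)).cfcₙ_nnreal
      NNReal.sqrt).symm.cfcₙ_nnreal NNReal.sqrt |>.symm
  have hcommT : Commute T (CFC.sqrt T * CFC.sqrt (T - 1)) :=
    (((Commute.refl T).cfcₙ_nnreal NNReal.sqrt).symm).mul_right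
      ((((Commute.refl T).sub_left (Commute.one_left T)).cfcₙ_nnreal NNReal.sqrt).symm)
  set r := CFC.sqrt T * CFC.sqrt (T - 1) with hr
  have hrsa : IsSelfAdjoint r := by
    rw [isSelfAdjoint_iff, hr, star_mul, (CFC.sqrt_nonneg T).isSelfAdjoint.star_eq,
      (CFC.sqrt_nonneg (T - 1)).isSelfAdjoint.star_eq, hcomm.eq]
  have hrr : r * r = C.adjoint.comp C := by
    have h1 : r * r = CFC.sqrt T * CFC.sqrt T * (CFC.sqrt (T - 1) * CFC.sqrt (T - 1)) := by
      rw [hr, mul_assoc, ← mul_assoc (CFC.sqrt (T - 1)), ← hcomm.eq]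
      simp only [mul_assoc]
    rw [h1, CFC.sqrt_mul_sqrt_self T hT0, CFC.sqrt_mul_sqrt_self _ hT1', hTT, mul_sub, mul_one]
  obtain ⟨U, hU1, hU2, hU3, hU4, hU5⟩ := exists_polar hrsa hrr hcC hcC'
  refine ⟨T, U, hT0, hT1, hU1, ?_, ?_⟩
  -- `T ≥ 1` is invertible, so `C* C = (T - 1) T` has the same range as `T - 1`.
  · obtain ⟨u, hu⟩ := CStarAlgebra.isUnit_of_le 1 hT1
    rw [hU2, ← closure_range_adjoint_comp C hcC, hTT]
    congr 1
    ext y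
    constructor
    · rintro ⟨x, rfl⟩
      exact ⟨T x, rfl⟩
    · rintro ⟨x, rfl⟩
      refine ⟨(↑u⁻¹ : Adj A (matchedRange Q hQ) (matchedRange Q hQ)) x, ?_⟩
      rw [← mul_apply, sub_mul, ← hu, mul_assoc, Units.mul_inv, mul_one]
  · have hadj : C.adjoint = r.comp U.adjoint := by
      rw [← hU3, adjoint_comp, ← star_eq_adjoint r, hrsa.star_eq]
    have hDU : D = (U.comp (1 - T)).comp U.adjoint := by
      -- On `R(C)`: `D C = C (1 - T) = U r (1 - T) = U (1 - T) r = U (1 - T) U* C`.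
      have hC' : ∀ x, D (C x) = ((U.comp (1 - T)).comp U.adjoint) (C x) := fun x => by
        have h1 : U.adjoint (C x) = r x := DFunLike.congr_fun hU4 x
        have h2 : T (r x) = r (T x) := DFunLike.congr_fun hcommT.eq x
        change D (C x) = U ((1 - T) (U.adjoint (C x)))
        rw [hDC, h1, Adj.sub_apply, one_apply, h2, map_sub, ← hU3]
        rfl
      refine ext fun v => ?_
      obtain ⟨y, hy, hvy⟩ := hcC v
      -- This vector lies in `R(U*)`, the closure of `R(r)`, and is killed by `r` because `r U* =
      -- C*`. As `r` is self-adjoint, the vector is orthogonal to itself.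
      have h1 : U.adjoint (v - y) = 0 := by
        rw [← CStarModule.inner_self (A := A)]
        refine inner_eq_zero_of_mem_closure r ?_ ?_
        · rw [← star_eq_adjoint, hrsa.star_eq, ← comp_apply, ← hadj, hvy]
        · rw [hU5, ← hU2]
          exact ⟨_, rfl⟩
      have h2 := hD0 _ hvy
      rw [map_sub, sub_eq_zero] at h1 h2
      rw [h2, eqOn_closure_range _ _ C hC' hy, comp_apply, comp_apply, ← h1]
      rfl
    rw [hB, hadj, hU3, ← hDU]
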